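/- Let $n\ge 1$, $m\ge 0$ and $d\ge 1$ be integers. For a set function $f:2^{[m]}\to\mathbb{R}$ put $f(S\mid T)=f(S\cup T)-f(T)$. A set $T\subseteq[m]$ is superadditive w.r.t. $f$ if there is $S\subseteq[m]\setminus T$ with $f(S\mid T)>f(S\mid T')$ for all $T'\subsetneq T$, and the superadditive width of $f$ is the largest cardinality of a superadditive set ($0$ if there is no nonempty one). Let $\mathrm{SAW}\text{-}d$ be the class of normalized ($f(\emptyset)=0$) monotone set functions over $[m]$ of superadditive width at most $d$, and let $\max(\mathrm{SAW}\text{-}d)$ be the class of pointwise maxima of finitely many (at least one) members of $\mathrm{SAW}\text{-}d$. In the Simultaneous Item First Price Auction (SIA), $n$ bidders simultaneously submit nonnegative bids on each of the $m$ items; each item goes to a highest bidder on that item (ties broken by an arbitrary fixed measurable, possibly randomized, rule), who pays his or her own bid on it. The utility of bidder $i$, who has valuation $f_i$, is $f_i$ of the set of items won minus the total payment. A coarse correlated equilibrium is a probability distribution over bid profiles (with finite expected utilities) in which no bidder can increase his or her expected utility by switching to a fixed bid vector. The price of anarchy (PoA) w.r.t. coarse correlated equilibria is the supremum, over all such equilibria,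 of $\mathrm{OPT}(f)/\mathbb{E}[\text{welfare in equilibrium}]$ (with $0/0=0$ and $x/0=\infty$ for $x>0$), where $\mathrm{OPT}(f)=\max\sum_i f_i(S_i)$ over all partitions $(S_1,\dots,S_n)$ of $[m]$, parts possibly empty. Theorem. If $f_1,\dots,f_n\in\max(\mathrm{SAW}\text{-}d)$, then, for every tie-breaking rule, SIA has price of anarchy at most $8d\cdot H_{\lceil m/(2d)\rceil}$ w.r.t. coarse correlated equilibria, where $H_k=\sum_{j=1}^k \frac1j$. Moreover, this bound is $O(d\log m)$: there is an absolute constant $C$ such that $8d\cdot H_{\lceil m/(2d)\rceil}\le C\,d\log m$ for all $m\ge 2$ and $d\ge 1$. -/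

import Mathlib

open scoped NNReal ENNReal

noncomputable section

/-! ### Set functions and superadditive width -/

/-- Real-valued set functions over the ground set `[m]`. -/
abbrev SetFn (m : ℕ) : Type := Finset (Fin m) → ℝ

/-- The margin `f(S | T) = f(S ∪ T) - f(T)` of `S` given `T`. -/
def SetFn.margin {m : ℕ} (f : SetFn m) (S T : Finset (Fin m)) : ℝ :=
  f (S ∪ T) - f T

/-- `T` is superadditive w.r.t. `f` if some `S` disjoint from `T` has a strictly larger margin
given `T` than given any proper subset of `T`. -/
def SetFn.IsSuperadditiveSet {m : ℕ} (f : SetFn m) (T : Finset (Fin m)) : Prop :=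
  ∃ S : Finset (Fin m), Disjoint S T ∧ ∀ T' : Finset (Fin m), T' ⊂ T → f.margin S T' < f.margin S T

open Classical in
/-- The superadditive width of `f`: the largest cardinality of a superadditive set
(the empty set is vacuously superadditive, so the width is `0` if there is no other). -/
def SetFn.superadditiveWidth {m : ℕ} (f : SetFn m) : ℕ :=
  (Finset.univ.filter fun T : Finset (Fin m) => f.IsSuperadditiveSet T).sup Finset.card

/-- Level `d` of the superadditive width hierarchy: normalized monotone set functions over `[m]`
of superadditive width at most `d`. -/
def SAW (m d : ℕ) : Set (SetFn m) :=
  {f | f ∅ = 0 ∧ Monotone f ∧ f.superadditiveWidth ≤ d}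

/-- The closure of a family of set functions under (pointwise) maximum of finitely many
members. The family `g` is necessarily nonempty since the range has a greatest element. -/
def maxClosure {m : ℕ} (F : Set (SetFn m)) : Set (SetFn m) :=
  {f | ∃ (k : ℕ) (g : Fin k → SetFn m), (∀ i, g i ∈ F) ∧
    ∀ S : Finset (Fin m), IsGreatest (Set.range fun i => g i S) (f S)}

/-! ### The simultaneous item first price auction with `n` bidders and `m` items -/

/-- A bid profile: bidder `i` bids `b i j ≥ 0` on item `j`. -/
abbrev BidProfile (n m : ℕ) : Type := Fin n → Fin m → ℝ≥0

/-- An allocation: item `j` goes to bidder `a j`. -/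
abbrev Allocation (n m : ℕ) : Type := Fin m → Fin n

/-- The set of items that bidder `i` gets. -/
def Allocation.bundle {n m : ℕ} (a : Allocation n m) (i : Fin n) : Finset (Fin m) :=
  Finset.univ.filter fun j => a j = i

/-- A (measurable, possibly randomized) way of selecting the winners: `prob b a` is the probability
that the allocation is `a` when the bids are `b`. Every item always goes to one of its highest
bidders; ties are broken in an arbitrary way. -/
structure WinnerRule (n m : ℕ) where
  prob : BidProfile n m → Allocation n m → ℝ
  measurable_prob : ∀ a, Measurable fun b => prob b a
  prob_nonneg : ∀ b a, 0 ≤ prob b a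
  sum_prob : ∀ b, ∑ a, prob b a = 1
  highest : ∀ b a, prob b a ≠ 0 → ∀ (j : Fin m) (i : Fin n), b i j ≤ b (a j) j

/-- The social welfare of an allocation under the valuation profile `f`. -/
def welfare {n m : ℕ} (f : Fin n → SetFn m) (a : Allocation n m) : ℝ :=
  ∑ i, f i (a.bundle i)

/-- The optimal social welfare. -/
def optWelfare {n m : ℕ} (f : Fin n → SetFn m) : ℝ :=
  ⨆ a : Allocation n m, welfare f a

/-- The (expected, over tie-breaking) quasi-linear utility of bidder `i` in the auction: the value
of the items won minus the sum of the bidder's own bids on them. -/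
def utility {n m : ℕ} (R : WinnerRule n m) (f : Fin n → SetFn m) (i : Fin n)
    (b : BidProfile n m) : ℝ :=
  ∑ a, R.prob b a * (f i (a.bundle i) - ∑ j ∈ a.bundle i, (b i j : ℝ))

/-- The (expected, over tie-breaking) social welfare of the outcome at a bid profile. -/
def outcomeWelfare {n m : ℕ} (R : WinnerRule n m) (f : Fin n → SetFn m)
    (b : BidProfile n m) : ℝ :=
  ∑ a, R.prob b a * welfare f a

/-- `σ` is a coarse correlated equilibrium: a distribution over bid profiles such that all expected
utilities are finite and no bidder can gain in expectation by switching to a fixed bid vector.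
(Utilities are bounded above, and deviating to the zero bid guarantees nonnegative utility, so
an expected utility of `-∞` is impossible in equilibrium.) -/
structure IsCoarseCorrelatedEq {n m : ℕ} (R : WinnerRule n m) (f : Fin n → SetFn m)
    (σ : MeasureTheory.Measure (BidProfile n m)) : Prop where
  isProbabilityMeasure : MeasureTheory.IsProbabilityMeasure σ
  integrable_utility : ∀ i, MeasureTheory.Integrable (utility R f i) σ
  no_deviation : ∀ (i : Fin n) (b' : Fin m → ℝ≥0),
    ∫ b, utility R f i (Function.update b i b') ∂σ ≤ ∫ b, utility R f i b ∂σ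

/-- The price of anarchy w.r.t. coarse correlated equilibria of the auction at the valuation
profile `f`: the supremum over all such equilibria of the ratio between the optimal welfare and the
expected equilibrium welfare (with `0 / 0 = 0` and `x / 0 = ∞` for `x > 0`). -/
def priceOfAnarchy {n m : ℕ} (R : WinnerRule n m) (f : Fin n → SetFn m) : ℝ≥0∞ :=
  ⨆ (σ : MeasureTheory.Measure (BidProfile n m)) (_ : IsCoarseCorrelatedEq R f σ),
    ENNReal.ofReal (optWelfare f) / ENNReal.ofReal (∫ b, outcomeWelfare R f b ∂σ)

end

/-! Two ingredients combine. Approximation (`maxClosure.exists_blocks`): every bundle `X` contains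
disjoint blocks of size at most `2d`, each worth a flat `c`, whose count bounds `f` from below on
unions of blocks and recovers `f X` up to `2 * H_r`, with `r = ⌈m/(2d)⌉`. The blocks are cut
greedily by value. Applying bounded width twice, removing block indices `I`, one of them the
earliest, loses at most `2 * f(I)` (`SAW.biUnion_le`), so any cover costs at least half of `f X`. If
no flat price worked, greedy set cover with its harmonic loss would give a cheaper cover
(`exists_uniform_le`).

Deviation (`IsCoarseCorrelatedEq.half_le`): a bidder offering a uniformly random bid in `[0,
c/(2d)]` on each item of the blocks pays on average at most half of their total value, and misses a
block with probability at most `2d/c` times its price. Hence half the block value is at most the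
equilibrium utility plus `2d` times the expected price of `X`. Summing over bidders, with utilities
plus revenue equal to welfare, yields `8 * d * H_r`. -/

/-- Each of the `k` terms added to `H_n` is at least `1/(n+k)`. This pays for one greedy removal in
`exists_cover_sum_lt`. -/
theorem harmonic_add_div_le (n k : ℕ) :
    (harmonic n : ℝ) + (k : ℝ) / ((n + k : ℕ) : ℝ) ≤ (harmonic (n + k) : ℝ) := by
  induction k with
  | zero => simp
  | succ k ih =>
    rw [← add_assoc, harmonic_succ]
    push_cast at ih ⊢
    have h : ((k : ℝ) + 1) / (n + k + 1) ≤ k / (n + k) + ((n : ℝ) + k + 1)⁻¹ := by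
      rw [add_div, one_div]
      gcongr ?_ + _
      rcases Nat.eq_zero_or_pos (n + k) with h0 | h0
      · obtain ⟨rfl, rfl⟩ : n = 0 ∧ k = 0 := by omega
        simp
      · have : (0 : ℝ) < n + k := by exact_mod_cast h0
        exact div_le_div_of_nonneg_left k.cast_nonneg this (by linarith)
    linarith

theorem harmonic_nonneg (n : ℕ) : (0 : ℝ) ≤ (harmonic n : ℝ) := by
  exact_mod_cast Finset.sum_nonneg fun i _ => by positivity

theorem harmonic_mono : Monotone fun n => (harmonic n : ℝ) :=
  monotone_nat_of_le_succ fun n =>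
    (harmonic_add_div_le n 1).trans' (le_add_of_nonneg_right (by positivity))

/-! ### Set functions that are subadditive along covers -/

/-- If removing from `J` a subset containing its least element costs at most twice the value of
that subset, then the value of `J` is at most twice the total value of any cover. -/
theorem le_two_mul_sum_of_cover {h : Finset ℕ → ℝ} (h0 : h ∅ = 0) (hmono : Monotone h)
    (hsub : ∀ I J : Finset ℕ, I ⊆ J → ∀ a ∈ I, (∀ b ∈ J, a ≤ b) → h J ≤ h (J \ I) + 2 * h I)
    (L : Multiset (Finset ℕ)) :
    ∀ J : Finset ℕ, (∀ x ∈ J, ∃ I ∈ L, x ∈ I) → h J ≤ 2 * (L.map h).sum := by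
  have hnn : ∀ I, 0 ≤ h I := fun I => h0 ▸ hmono (Finset.empty_subset I)
  induction hn : L.card generalizing L with
  | zero =>
    intro J hJ
    obtain rfl := Multiset.card_eq_zero.1 hn
    obtain rfl : J = ∅ := Finset.eq_empty_of_forall_notMem fun x hx => by simpa using hJ x hx
    simp [h0]
  | succ n ih =>
    intro J hJ
    rcases J.eq_empty_or_nonempty with rfl | hne
    · rw [h0]
      have : 0 ≤ (L.map h).sum := Multiset.sum_nonneg fun y hy => by
        obtain ⟨I, -, rfl⟩ := Multiset.mem_map.1 hy
        exact hnn I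
      linarith
    -- Removing the cover member that contains the least element of `J` is what makes `hsub`
    -- applicable to `I ∩ J`.
    · obtain ⟨I, hI, hmin⟩ := hJ _ (J.min'_mem hne)
      obtain ⟨L', rfl⟩ := Multiset.exists_cons_of_mem hI
      have h1 := hsub (I ∩ J) J Finset.inter_subset_right (J.min' hne)
        (Finset.mem_inter.2 ⟨hmin, J.min'_mem hne⟩) fun b hb => J.min'_le b hb
      have h2 := ih L' (by simpa using hn) (J \ (I ∩ J)) fun x hx => by
        simp only [Finset.mem_sdiff, Finset.mem_inter, not_and'] at hx
        obtain ⟨K, hK, hxK⟩ := hJ x hx.1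
        rcases Multiset.mem_cons.1 hK with rfl | hK
        · exact absurd hxK (hx.2 hx.1)
        · exact ⟨K, hK, hxK⟩
      have h3 : h (I ∩ J) ≤ h I := hmono Finset.inter_subset_left
      rw [Multiset.map_cons, Multiset.sum_cons]
      linarith

/-- Repeatedly removing a set of small average value produces a cheap cover. -/
theorem exists_cover_sum_lt {h : Finset ℕ → ℝ} {J : Finset ℕ} {V : ℝ} (hV : 0 ≤ V)
    (hcheap : ∀ R ⊆ J, R.Nonempty → ∃ I ⊆ R, I.Nonempty ∧ h I < V * (I.card / R.card)) :
    ∀ R ⊆ J, R.Nonempty → ∃ L : Multiset (Finset ℕ),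
      (∀ x ∈ R, ∃ I ∈ L, x ∈ I) ∧ (L.map h).sum < V * harmonic R.card := by
  intro R
  induction R using Finset.strongInduction with
  | H R ih =>
    intro hRJ hR
    obtain ⟨I, hIR, hI, hlt⟩ := hcheap R hRJ hR
    have hrest : ∃ L : Multiset (Finset ℕ), (∀ x ∈ R \ I, ∃ I ∈ L, x ∈ I) ∧
        (L.map h).sum ≤ V * harmonic (R \ I).card := by
      rcases (R \ I).eq_empty_or_nonempty with he | hne
      · exact ⟨0, fun x hx => by rw [he] at hx; simp at hx, by rw [he]; simp⟩
      · obtain ⟨L, hL, hs⟩ := ih _ (Finset.sdiff_ssubset hIR hI)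
          (Finset.sdiff_subset.trans hRJ) hne
        exact ⟨L, hL, hs.le⟩
    obtain ⟨L, hL, hs⟩ := hrest
    refine ⟨I ::ₘ L, fun x hx => ?_, ?_⟩
    · by_cases hxI : x ∈ I
      · exact ⟨I, Multiset.mem_cons_self _ _, hxI⟩
      · obtain ⟨K, hK, hxK⟩ := hL x (Finset.mem_sdiff.2 ⟨hx, hxI⟩)
        exact ⟨K, Multiset.mem_cons_of_mem hK, hxK⟩
    · have h1 := harmonic_add_div_le (R \ I).card I.card
      rw [Finset.card_sdiff_add_card_eq_card hIR] at h1
      have h2 := mul_le_mul_of_nonneg_left h1 hV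
      rw [Multiset.map_cons, Multiset.sum_cons]
      linarith

/-- Under the hypotheses of `le_two_mul_sum_of_cover`, some uniform additive function lies below
`h` and recovers the value of `J` up to a factor `2 * harmonic J.card`. -/
theorem exists_uniform_le {h : Finset ℕ → ℝ} (h0 : h ∅ = 0) (hmono : Monotone h)
    (hsub : ∀ I J : Finset ℕ, I ⊆ J → ∀ a ∈ I, (∀ b ∈ J, a ≤ b) → h J ≤ h (J \ I) + 2 * h I)
    (J : Finset ℕ) :
    ∃ R ⊆ J, ∃ c : ℝ, 0 ≤ c ∧ (∀ I ⊆ R, c * I.card ≤ h I) ∧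
      h J ≤ 2 * harmonic J.card * (c * R.card) := by
  have hnn : ∀ I, 0 ≤ h I := fun I => h0 ▸ hmono (Finset.empty_subset I)
  rcases J.eq_empty_or_nonempty with rfl | hJ
  · exact ⟨∅, subset_rfl, 0, le_rfl, fun I _ => by simpa using hnn I, by simp [h0]⟩
  have hH : (0 : ℝ) < harmonic J.card := by
    exact_mod_cast harmonic_pos (Finset.card_pos.2 hJ).ne'
  -- Chosen so that a cover of cost below `V * harmonic J.card` costs less than half of `h J`,
  -- contradicting `le_two_mul_sum_of_cover`. A set `R` without a cheap subset would satisfy the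
  -- claim with `c = V / R.card`.
  set V : ℝ := h J / (2 * harmonic J.card) with hVdef
  have hV : 0 ≤ V := div_nonneg (hnn J) (by positivity)
  have hVJ : h J = 2 * (V * harmonic J.card) := by
    rw [hVdef]
    field_simp
  by_contra hcon
  obtain ⟨L, hL, hlt⟩ := exists_cover_sum_lt (h := h) (J := J) hV (fun R hRJ hR => by
    by_contra hno
    have hRc : (0 : ℝ) < R.card := by exact_mod_cast Finset.card_pos.2 hR
    refine hcon ⟨R, hRJ, V / R.card, div_nonneg hV hRc.le, fun I hI => ?_, ?_⟩
    · rcases I.eq_empty_or_nonempty with rfl | hIne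
      · simp [h0]
      · have h1 : V * (I.card / R.card) ≤ h I :=
          not_lt.1 fun h2 => hno ⟨I, hI, hIne, h2⟩
        exact h1.trans' (le_of_eq (by ring))
    · rw [div_mul_cancel₀ _ hRc.ne', hVJ]
      exact le_of_eq (by ring)) J subset_rfl hJ
  have := le_two_mul_sum_of_cover h0 hmono hsub L J hL
  linarith

/-! ### Approximating functions of bounded superadditive width -/

variable {m : ℕ}

/-- An inclusion-minimal `T' ⊆ T` whose margin is still at least that of `T` is superadditive, with
`S` as witness. -/
theorem SetFn.exists_subset_margin_le (f : SetFn m) {S T : Finset (Fin m)} (hST : Disjoint S T) :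
    ∃ T' ⊆ T, T'.card ≤ f.superadditiveWidth ∧ f.margin S T ≤ f.margin S T' := by
  classical
  obtain ⟨T', hT'⟩ := (T.powerset.filter fun T' => f.margin S T ≤ f.margin S T').exists_minimal
    ⟨T, by simp⟩
  have hmem := hT'.1
  simp only [Finset.mem_filter, Finset.mem_powerset] at hmem
  refine ⟨T', hmem.1, ?_, hmem.2⟩
  refine Finset.le_sup (f := Finset.card) (Finset.mem_filter.2 ⟨Finset.mem_univ _, S,
    hST.mono_right hmem.1, fun T'' hT'' => ?_⟩)
  by_contra! hle
  refine hT''.2 (hT'.2 (Finset.mem_filter.2 ⟨?_, hmem.2.trans hle⟩) hT''.1)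
  exact Finset.mem_powerset.2 (hT''.1.trans hmem.1)

theorem SAW.nonneg {d : ℕ} {f : SetFn m} (hf : f ∈ SAW m d) (S : Finset (Fin m)) : 0 ≤ f S :=
  hf.1 ▸ hf.2.1 (Finset.empty_subset S)

theorem SAW.exists_union_le {d : ℕ} {f : SetFn m} (hf : f ∈ SAW m d) {S T : Finset (Fin m)}
    (hST : Disjoint S T) : ∃ T' ⊆ T, T'.card ≤ d ∧ f (S ∪ T) ≤ f T + f (S ∪ T') := by
  obtain ⟨T', hT', hcard, hle⟩ := f.exists_subset_margin_le hST
  refine ⟨T', hT', hcard.trans hf.2.2, ?_⟩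
  have := SAW.nonneg hf T'
  unfold SetFn.margin at hle
  linarith

/-- Greedy decomposition of a set into blocks of bounded size, each of largest value among the
sets of that size disjoint from the earlier blocks. -/
theorem exists_greedy_blocks {f : SetFn m} (hf : Monotone f) (k : ℕ) : ∀ (r : ℕ)
    (X : Finset (Fin m)), X.card ≤ k * r → ∃ Q : ℕ → Finset (Fin m),
      (∀ l, Q l ⊆ X) ∧ (∀ l, (Q l).card ≤ k) ∧ (∀ l l', l < l' → Disjoint (Q l) (Q l')) ∧
      (Finset.range r).biUnion Q = X ∧
      ∀ l, ∀ Y ⊆ X, Y.card ≤ k → (∀ l' < l, Disjoint Y (Q l')) → f Y ≤ f (Q l) := by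
  intro r
  induction r with
  | zero =>
    intro X hX
    obtain rfl : X = ∅ := by simpa using hX
    exact ⟨fun _ => ∅, by simp, by simp, by simp, by simp, fun l Y hY _ _ => hf hY⟩
  | succ r ih =>
    intro X hX
    obtain ⟨A, hA, hmax⟩ := (X.powerset.filter fun A => A.card = min k X.card).exists_max_image f
      (by
        obtain ⟨A, hA, hc⟩ := Finset.exists_subset_card_eq (min_le_right k X.card)
        exact ⟨A, by simp [hA, hc]⟩)
    simp only [Finset.mem_filter, Finset.mem_powerset] at hA hmax
    obtain ⟨Q, hQX, hcard, hdisj, hun, hgr⟩ := ih (X \ A) (by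
      rw [Finset.card_sdiff_of_subset hA.1, hA.2]
      rw [mul_add, mul_one] at hX
      omega)
    have hQA : ∀ l, Disjoint A (Q l) := fun l =>
      Finset.disjoint_sdiff.mono_right (hQX l)
    refine ⟨fun l => Nat.casesOn l A Q, ?_, ?_, ?_, ?_, ?_⟩
    · rintro (_ | l)
      · exact hA.1
      · exact (hQX l).trans Finset.sdiff_subset
    · rintro (_ | l)
      · simp [hA.2]
      · exact hcard l
    · rintro (_ | l) (_ | l') hll
      · exact absurd hll (lt_irrefl _)
      · exact hQA l'
      · exact absurd hll (by omega)
      · exact hdisj l l' (by omega)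
    · have h1 : (Finset.range r).biUnion Q ∪ A = X := by
        rw [hun, Finset.sdiff_union_of_subset hA.1]
      rw [← h1]
      ext x
      simp only [Finset.mem_biUnion, Finset.mem_union, Finset.mem_range]
      constructor
      · rintro ⟨_ | l, hl, hx⟩
        · exact Or.inr hx
        · exact Or.inl ⟨l, by omega, hx⟩
      · rintro (⟨l, hl, hx⟩ | hx)
        · exact ⟨l + 1, by omega, hx⟩
        · exact ⟨0, by omega, hx⟩
    · rintro (_ | l) Y hY hYc hd
      -- Competitors smaller than the block are padded to its exact size, at no loss by
      -- monotonicity.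
      · obtain ⟨B, hYB, hBX, hB⟩ := Finset.exists_subsuperset_card_eq hY
          (le_min hYc (Finset.card_le_card hY)) (min_le_right k X.card)
        exact (hf hYB).trans (hmax B ⟨hBX, hB⟩)
      · exact hgr l Y (Finset.subset_sdiff.2 ⟨hY, hd 0 (by omega)⟩) hYc fun l' hl' => hd (l' + 1) (by omega)

/-- The value of the union of the blocks in `J` drops by at most twice the value of the union of
the blocks in `I` when the latter, containing the first block, are removed. -/
theorem SAW.biUnion_le {d : ℕ} {f : SetFn m} (hf : f ∈ SAW m d) {X : Finset (Fin m)}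
    {Q : ℕ → Finset (Fin m)} (hQX : ∀ l, Q l ⊆ X) (hdisj : ∀ l l', l < l' → Disjoint (Q l) (Q l'))
    (hgr : ∀ l, ∀ Y ⊆ X, Y.card ≤ 2 * d → (∀ l' < l, Disjoint Y (Q l')) → f Y ≤ f (Q l))
    {I J : Finset ℕ} (hIJ : I ⊆ J) {a : ℕ} (haI : a ∈ I) (haJ : ∀ b ∈ J, a ≤ b) :
    f (J.biUnion Q) ≤ f ((J \ I).biUnion Q) + 2 * f (I.biUnion Q) := by
  have hpair : ∀ l l', l ≠ l' → Disjoint (Q l) (Q l') := fun l l' hne =>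
    hne.lt_or_gt.elim (hdisj l l') fun h => (hdisj l' l h).symm
  have hd : Disjoint (I.biUnion Q) ((J \ I).biUnion Q) := by
    simp only [Finset.disjoint_biUnion_left, Finset.disjoint_biUnion_right]
    rintro l hl l' hl'
    exact hpair _ _ fun h => (Finset.mem_sdiff.1 hl).2 (h ▸ hl')
  have hunion : I.biUnion Q ∪ (J \ I).biUnion Q = J.biUnion Q := by
    rw [← Finset.union_biUnion, Finset.union_sdiff_of_subset hIJ]
  -- The width bound is used once in each direction: the rest shrinks to `T`, then the union over
  -- `I` shrinks to `U`. The at most `2 * d` items of `T ∪ U` were all available when block `a` was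
  -- chosen, whence the block size `2 * d`.
  obtain ⟨T, hT, hTc, h1⟩ := SAW.exists_union_le hf hd
  obtain ⟨U, hU, hUc, h2⟩ := SAW.exists_union_le hf (hd.symm.mono_left hT)
  have hTJ : T ∪ U ⊆ J.biUnion Q := by
    rw [← hunion, Finset.union_comm]
    exact Finset.union_subset_union hU hT
  have h3 : f (T ∪ U) ≤ f (Q a) := by
    refine hgr a _ (hTJ.trans (Finset.biUnion_subset.2 fun l _ => hQX l))
      ((Finset.card_union_le _ _).trans (by omega)) fun l hl => ?_
    refine Disjoint.mono_left hTJ ?_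
    rw [Finset.disjoint_biUnion_left]
    exact fun b hb => hpair b l (hl.trans_le (haJ b hb)).ne'
  have h4 : f (Q a) ≤ f (I.biUnion Q) := hf.2.1 (Finset.subset_biUnion_of_mem Q haI)
  rw [hunion] at h1
  rw [Finset.union_comm] at h2
  linarith

/-- At every set, a function of superadditive width at most `d` is approximated from below by
counting disjoint blocks of size at most `2 * d`. -/
theorem SAW.exists_blocks {d r : ℕ} {f : SetFn m} (hf : f ∈ SAW m d) (hr : m ≤ 2 * d * r)
    (X : Finset (Fin m)) :
    ∃ (R : Finset ℕ) (Q : ℕ → Finset (Fin m)) (c : ℝ), 0 ≤ c ∧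
      (∀ l, Q l ⊆ X) ∧ (∀ l, (Q l).card ≤ 2 * d) ∧ (∀ l l', l ≠ l' → Disjoint (Q l) (Q l')) ∧
      (∀ I ⊆ R, c * I.card ≤ f (I.biUnion Q)) ∧ f X ≤ 2 * harmonic r * (c * R.card) := by
  obtain ⟨Q, hQX, hcard, hdisj, hun, hgr⟩ := exists_greedy_blocks hf.2.1 (2 * d) r X
    ((Finset.card_le_univ X).trans (by simpa using hr))
  obtain ⟨R, -, c, hc, hle, hJ⟩ := exists_uniform_le (h := fun I => f (I.biUnion Q))
    (by simpa using hf.1) (fun I J hIJ => hf.2.1 (Finset.biUnion_subset_biUnion_of_subset_left Q hIJ))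
    (fun I J hIJ a ha hJ => SAW.biUnion_le hf hQX hdisj hgr hIJ ha hJ) (Finset.range r)
  refine ⟨R, Q, c, hc, hQX, hcard, fun l l' hne => hne.lt_or_gt.elim (hdisj l l') fun h =>
    (hdisj l' l h).symm, hle, ?_⟩
  simpa [hun] using hJ

/-- The member attaining the maximum at `X` agrees with `f` there and lies below `f` elsewhere, so
its approximation serves `f`. -/
theorem maxClosure.exists_blocks {d r : ℕ} {f : SetFn m} (hf : f ∈ maxClosure (SAW m d))
    (hr : m ≤ 2 * d * r) (X : Finset (Fin m)) :
    ∃ (R : Finset ℕ) (Q : ℕ → Finset (Fin m)) (c : ℝ), 0 ≤ c ∧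
      (∀ l, Q l ⊆ X) ∧ (∀ l, (Q l).card ≤ 2 * d) ∧ (∀ l l', l ≠ l' → Disjoint (Q l) (Q l')) ∧
      (∀ I ⊆ R, c * I.card ≤ f (I.biUnion Q)) ∧ f X ≤ 2 * harmonic r * (c * R.card) := by
  obtain ⟨k, g, hg, hmax⟩ := hf
  obtain ⟨i, hi⟩ := (hmax X).1
  obtain ⟨R, Q, c, hc, hQX, hcard, hdisj, hle, hX⟩ := SAW.exists_blocks (hg i) hr X
  exact ⟨R, Q, c, hc, hQX, hcard, hdisj, fun I hI => (hle I hI).trans ((hmax _).2 ⟨i, rfl⟩),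
    hi ▸ hX⟩

theorem maxClosure.monotone {d : ℕ} {f : SetFn m} (hf : f ∈ maxClosure (SAW m d)) :
    Monotone f := by
  obtain ⟨k, g, hg, hmax⟩ := hf
  intro S T hST
  obtain ⟨i, hi⟩ := (hmax S).1
  exact hi ▸ ((hg i).2.1 hST).trans ((hmax T).2 ⟨i, rfl⟩)

theorem maxClosure.map_empty {d : ℕ} {f : SetFn m} (hf : f ∈ maxClosure (SAW m d)) :
    f ∅ = 0 := by
  obtain ⟨k, g, hg, hmax⟩ := hf
  obtain ⟨i, hi⟩ := (hmax ∅).1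
  exact hi ▸ (hg i).1


/-! ### Bids, revenue and deviations in the auction -/

variable {n : ℕ}

theorem WinnerRule.prob_le_one (R : WinnerRule n m) (b : BidProfile n m) (a : Allocation n m) :
    R.prob b a ≤ 1 :=
  R.sum_prob b ▸ Finset.single_le_sum (fun a _ => R.prob_nonneg b a) (Finset.mem_univ a)

theorem WinnerRule.integrable_prob (R : WinnerRule n m) {Ω : Type*} [MeasurableSpace Ω]
    {σ : MeasureTheory.Measure Ω} [MeasureTheory.IsFiniteMeasure σ] {g : Ω → BidProfile n m}
    (hg : Measurable g) (a : Allocation n m) :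
    MeasureTheory.Integrable (fun ω => R.prob (g ω) a) σ :=
  MeasureTheory.Integrable.of_bound ((R.measurable_prob a).comp hg).aestronglyMeasurable 1
    (Filter.Eventually.of_forall fun ω => by
      rw [Real.norm_of_nonneg (R.prob_nonneg _ _)]
      exact R.prob_le_one _ _)

/-- The highest bid on item `j`. -/
noncomputable def BidProfile.topBid (b : BidProfile n m) (j : Fin m) : ℝ :=
  ((Finset.univ.sup fun i => b i j : ℝ≥0) : ℝ)

theorem BidProfile.topBid_nonneg (b : BidProfile n m) (j : Fin m) : 0 ≤ b.topBid j :=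
  NNReal.coe_nonneg _

theorem BidProfile.le_topBid (b : BidProfile n m) (i : Fin n) (j : Fin m) :
    (b i j : ℝ) ≤ b.topBid j :=
  NNReal.coe_le_coe.2 (Finset.le_sup (f := fun i => b i j) (Finset.mem_univ i))

theorem BidProfile.measurable_topBid (j : Fin m) :
    Measurable fun b : BidProfile n m => b.topBid j := by
  have h : Measurable fun b : BidProfile n m => Finset.univ.sup fun i => b i j := by
    have h1 : Measurable (Finset.univ.sup fun (i : Fin n) (b : BidProfile n m) => b i j) :=
      Finset.sup_induction measurable_const (fun _ hg _ hg' => hg.sup hg') fun i _ => by fun_prop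
    convert h1 using 1
    ext b
    rw [Finset.sup_apply]
  exact h.coe_nnreal_real

theorem WinnerRule.topBid_eq (R : WinnerRule n m) {b : BidProfile n m} {a : Allocation n m}
    (h : R.prob b a ≠ 0) (j : Fin m) : b.topBid j = b (a j) j :=
  le_antisymm (NNReal.coe_le_coe.2 (Finset.sup_le fun i _ => R.highest b a h j i))
    (b.le_topBid _ _)

theorem Allocation.mem_bundle {a : Allocation n m} {i : Fin n} {j : Fin m} :
    j ∈ a.bundle i ↔ a j = i := by
  simp [Allocation.bundle]

theorem Allocation.sum_bundle (a : Allocation n m) (p : Fin n → Fin m → ℝ) :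
    ∑ i, ∑ j ∈ a.bundle i, p i j = ∑ j, p (a j) j := by
  rw [← Finset.sum_fiberwise Finset.univ a]
  refine Finset.sum_congr rfl fun i _ => Finset.sum_congr rfl fun j hj => ?_
  rw [Allocation.mem_bundle.1 hj]

/-- Welfare is split into the utilities of the bidders and the revenue. -/
theorem sum_utility_add_revenue (R : WinnerRule n m) (f : Fin n → SetFn m)
    (b : BidProfile n m) :
    ∑ i, utility R f i b + ∑ j, b.topBid j = outcomeWelfare R f b := by
  have h : ∑ j, b.topBid j = ∑ a, R.prob b a * ∑ j, b.topBid j := by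
    rw [← Finset.sum_mul, R.sum_prob, one_mul]
  unfold utility outcomeWelfare welfare
  rw [h, Finset.sum_comm, ← Finset.sum_add_distrib]
  refine Finset.sum_congr rfl fun a _ => ?_
  by_cases ha : R.prob b a = 0
  · simp [ha]
  · rw [← Finset.mul_sum, Finset.sum_sub_distrib, a.sum_bundle fun i j => (b i j : ℝ),
      Finset.sum_congr rfl fun j _ => R.topBid_eq ha j]
    ring

/-- The bid vector offering `x` for each item of `D` and nothing for the other items. -/
def flatBid (D : Finset (Fin m)) (x : ℝ≥0) : Fin m → ℝ≥0 :=
  fun j => if j ∈ D then x else 0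

/-- A flat bid wins all items whose highest bid it exceeds, and costs at most `x` per item. -/
theorem le_utility_flatBid (R : WinnerRule n m) (f : Fin n → SetFn m) (i : Fin n)
    (b : BidProfile n m) (D : Finset (Fin m)) (x : ℝ≥0) {v : ℝ}
    (hv : ∀ B : Finset (Fin m), (∀ j ∈ D, b.topBid j < x → j ∈ B) → v ≤ f i B) :
    v - x * D.card ≤ utility R f i (Function.update b i (flatBid D x)) := by
  set b' := Function.update b i (flatBid D x) with hb'
  have h : v - x * D.card = ∑ a, R.prob b' a * (v - x * D.card) := by
    rw [← Finset.sum_mul, R.sum_prob, one_mul]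
  rw [h]
  refine Finset.sum_le_sum fun a _ => ?_
  by_cases ha : R.prob b' a = 0
  · simp [ha]
  refine mul_le_mul_of_nonneg_left (sub_le_sub (hv _ fun j hj hlt => ?_) ?_) (R.prob_nonneg _ _)
  · rw [Allocation.mem_bundle]
    by_contra hne
    have h1 := R.highest b' a ha j i
    rw [hb', Function.update_self, Function.update_of_ne hne, flatBid, if_pos hj] at h1
    have h2 : (x : ℝ) ≤ b (a j) j := NNReal.coe_le_coe.2 h1
    exact (h2.trans (b.le_topBid _ _)).not_gt hlt
  · have h1 : ∀ j, (b' i j : ℝ) = if j ∈ D then (x : ℝ) else 0 := fun j => by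
      rw [hb', Function.update_self, flatBid]
      split_ifs <;> rfl
    calc ∑ j ∈ a.bundle i, (b' i j : ℝ) ≤ ∑ j, (b' i j : ℝ) :=
          Finset.sum_le_univ_sum_of_nonneg fun j => NNReal.coe_nonneg _
      _ = x * D.card := by
          simp only [h1, Finset.sum_ite_mem, Finset.univ_inter, Finset.sum_const, nsmul_eq_mul]
          ring

/-- Once the bids of `i` are fixed, the payments no longer depend on `b`; only the bounded
probabilities vary. -/
theorem integrable_utility_update (R : WinnerRule n m) (f : Fin n → SetFn m) (i : Fin n)
    (σ : MeasureTheory.Measure (BidProfile n m)) [MeasureTheory.IsFiniteMeasure σ]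
    (b' : Fin m → ℝ≥0) :
    MeasureTheory.Integrable (fun b => utility R f i (Function.update b i b')) σ := by
  unfold utility
  simp only [Function.update_self]
  exact MeasureTheory.integrable_finsetSum _ fun a _ =>
    (R.integrable_prob measurable_update_left a).mul_const _

theorem integrable_outcomeWelfare (R : WinnerRule n m) (f : Fin n → SetFn m)
    (σ : MeasureTheory.Measure (BidProfile n m)) [MeasureTheory.IsFiniteMeasure σ] :
    MeasureTheory.Integrable (outcomeWelfare R f) σ :=
  MeasureTheory.integrable_finsetSum _ fun a _ =>
    (R.integrable_prob measurable_id a).mul_const _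

/-- Among the bids `t * (c / (k * N))` with `t < N`, at least about a fraction `1 - k * P / c`
exceeds `P`. -/
theorem le_mul_card_filter_lt {c P : ℝ} (hc : 0 ≤ c) (hP : 0 ≤ P) {k N : ℕ} (hk : 0 < k)
    (hN : 0 < N) :
    c * (N - 1) - k * N * P ≤
      c * ((Finset.range N).filter fun t : ℕ => P < t * (c / (k * N))).card := by
  rcases hc.eq_or_lt with rfl | hc
  · simp only [zero_mul, zero_sub, Left.neg_nonpos_iff]
    positivity
  have hk' : (0 : ℝ) < k := by exact_mod_cast hk
  have hN' : (0 : ℝ) < N := by exact_mod_cast hN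
  set δ : ℝ := c / (k * N) with hδ
  have hδ0 : 0 < δ := by positivity
  have h1 := Finset.card_filter_add_card_filter_not (s := Finset.range N)
    fun t : ℕ => P < t * δ
  -- The extra one counts `t = 0` and causes the `N - 1` in the bound.
  have h2 : ((Finset.range N).filter fun t : ℕ => ¬ P < t * δ).card ≤ ⌊P / δ⌋₊ + 1 := by
    conv_rhs => rw [← Finset.card_range (⌊P / δ⌋₊ + 1)]
    refine Finset.card_le_card fun t ht => ?_
    rw [Finset.mem_range, Nat.lt_succ_iff]
    exact Nat.le_floor ((le_div_iff₀ hδ0).2 (not_lt.1 (Finset.mem_filter.1 ht).2))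
  have h3 : (N : ℝ) - 1 - P / δ ≤ ((Finset.range N).filter fun t : ℕ => P < t * δ).card := by
    have h4 := Nat.floor_le (div_nonneg hP hδ0.le)
    have h5 : (N : ℝ) ≤ ((Finset.range N).filter fun t : ℕ => P < t * δ).card
        + (⌊P / δ⌋₊ + 1) := by
      rw [Finset.card_range] at h1
      exact_mod_cast (by omega : N ≤ _ + (⌊P / δ⌋₊ + 1))
    linarith
  refine (mul_le_mul_of_nonneg_left h3 hc.le).trans' (le_of_eq ?_)
  rw [hδ]
  field_simp

/-- The average utility from the flat bids `t * (c / (k * N))`, `t < N`, on the union of the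
blocks. -/
theorem le_sum_utility_flatBid (R : WinnerRule n m) (f : Fin n → SetFn m) (i : Fin n)
    (hf : Monotone (f i)) {k N : ℕ} (hk : 0 < k) (hN : 0 < N) {X : Finset (Fin m)}
    {J : Finset ℕ} {Q : ℕ → Finset (Fin m)} {c : ℝ≥0} (hQX : ∀ l, Q l ⊆ X)
    (hcard : ∀ l, (Q l).card ≤ k) (hdisj : ∀ l l', l ≠ l' → Disjoint (Q l) (Q l'))
    (hle : ∀ I ⊆ J, c * I.card ≤ f i (I.biUnion Q)) (b : BidProfile n m) :
    c * J.card * ((N - 1) / 2) - k * N * ∑ j ∈ X, b.topBid j ≤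
      ∑ t ∈ Finset.range N, utility R f i
        (Function.update b i (flatBid (J.biUnion Q) (t * (c / (k * N))))) := by
  have hk' : (0 : ℝ) < k := by exact_mod_cast hk
  have hN' : (0 : ℝ) < N := by exact_mod_cast hN
  -- A per-item bid above the total price of a block beats every single price in it, so the whole
  -- block is won.
  set P : ℕ → ℝ := fun l => ∑ j ∈ Q l, b.topBid j with hPdef
  have hP : ∀ l, 0 ≤ P l := fun l => Finset.sum_nonneg fun j _ => b.topBid_nonneg j
  set x : ℕ → ℝ := fun t => t * (c / (k * N)) with hx
  have hx0 : ∀ t, 0 ≤ x t := fun t => by positivity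
  have hD : ((J.biUnion Q).card : ℝ) ≤ k * J.card := by
    rw [mul_comm]
    exact_mod_cast Finset.card_biUnion_le_card_mul J Q k fun l _ => hcard l
  have hterm : ∀ t ∈ Finset.range N,
      c * (J.filter fun l => P l < x t).card - x t * (k * J.card) ≤ utility R f i
        (Function.update b i (flatBid (J.biUnion Q) (t * (c / (k * N))))) := by
    intro t _
    have h := le_utility_flatBid R f i b (J.biUnion Q) (t * (c / (k * N)))
      (v := c * (J.filter fun l => P l < x t).card) fun B hB => by
        refine (hle _ (Finset.filter_subset _ _)).trans (hf ?_)
        refine Finset.biUnion_subset.2 fun l hl j hj => ?_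
        rw [Finset.mem_filter] at hl
        refine hB j (Finset.mem_biUnion.2 ⟨l, hl.1, hj⟩) (lt_of_le_of_lt ?_ (hl.2.trans_eq ?_))
        · exact Finset.single_le_sum (fun j _ => b.topBid_nonneg j) hj
        · push_cast
          rfl
    refine h.trans' (sub_le_sub_left ?_ _)
    push_cast
    exact mul_le_mul_of_nonneg_left hD (hx0 t)
  refine (Finset.sum_le_sum hterm).trans' ?_
  rw [Finset.sum_sub_distrib, ← Finset.sum_mul, ← Finset.mul_sum]
  have hxs : (∑ t ∈ Finset.range N, x t) * (k * J.card) = c * J.card * ((N - 1) / 2) := by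
    have h1 : (∑ t ∈ Finset.range N, (t : ℝ)) * 2 = N * (N - 1) := by
      have := Finset.sum_range_id_mul_two N
      have h2 : ((N - 1 : ℕ) : ℝ) = N - 1 := by
        rw [Nat.cast_sub hN, Nat.cast_one]
      rw [← h2, ← Nat.cast_mul, ← this]
      push_cast
      rfl
    have h3 : (∑ t ∈ Finset.range N, (t : ℝ)) = N * (N - 1) / 2 := by linarith
    rw [hx, ← Finset.sum_mul, h3]
    field_simp
  -- Double counting of the pairs of a bid and a block it surely wins.
  have hcount : (∑ t ∈ Finset.range N, ((J.filter fun l => P l < x t).card : ℝ)) =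
      ∑ l ∈ J, (((Finset.range N).filter fun t : ℕ => P l < t * (c / (k * N))).card : ℝ) := by
    rw [← Nat.cast_sum, ← Nat.cast_sum]
    exact congrArg _ <| Finset.sum_card_bipartiteAbove_eq_sum_card_bipartiteBelow
      (s := Finset.range N) (t := J) fun t l => P l < x t
  have hsum : ∑ l ∈ J, (c * (N - 1) - k * N * P l) ≤
      c * ∑ l ∈ J, (((Finset.range N).filter fun t : ℕ => P l < t * (c / (k * N))).card : ℝ) := by
    rw [Finset.mul_sum]
    exact Finset.sum_le_sum fun l _ => le_mul_card_filter_lt c.coe_nonneg (hP l) hk hN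
  have hPX : ∑ l ∈ J, P l ≤ ∑ j ∈ X, b.topBid j := by
    rw [hPdef, ← Finset.sum_biUnion fun l _ l' _ hne => hdisj l l' hne]
    exact Finset.sum_le_sum_of_subset_of_nonneg (Finset.biUnion_subset.2 fun l _ => hQX l)
      fun j _ _ => b.topBid_nonneg j
  have hPX' := mul_le_mul_of_nonneg_left hPX (by positivity : (0 : ℝ) ≤ k * N)
  rw [Finset.sum_sub_distrib, Finset.sum_const, nsmul_eq_mul, ← Finset.mul_sum] at hsum
  rw [hcount, hxs]
  nlinarith

/-! ### Coarse correlated equilibria: expected utilities, prices and welfare. -/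

variable {R : WinnerRule n m} {f : Fin n → SetFn m}
  {σ : MeasureTheory.Measure (BidProfile n m)}

theorem IsCoarseCorrelatedEq.integral_utility_nonneg (hσ : IsCoarseCorrelatedEq R f σ) (i : Fin n)
    (hf : ∀ S, 0 ≤ f i S) : 0 ≤ ∫ b, utility R f i b ∂σ :=
  (hσ.no_deviation i (flatBid ∅ 0)).trans' (MeasureTheory.integral_nonneg fun b => by
    simpa using le_utility_flatBid R f i b ∅ 0 (v := 0) fun B _ => hf B)

/-- Revenue is bounded welfare minus integrable utilities, and it dominates each single price. -/
theorem IsCoarseCorrelatedEq.integrable_topBid (hσ : IsCoarseCorrelatedEq R f σ) (j : Fin m) :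
    MeasureTheory.Integrable (fun b : BidProfile n m => b.topBid j) σ := by
  have := hσ.isProbabilityMeasure
  have h : MeasureTheory.Integrable
      (fun b => outcomeWelfare R f b - ∑ i, utility R f i b) σ :=
    (integrable_outcomeWelfare R f σ).sub
      (MeasureTheory.integrable_finsetSum _ fun i _ => hσ.integrable_utility i)
  refine h.mono' (BidProfile.measurable_topBid j).aestronglyMeasurable
    (Filter.Eventually.of_forall fun b => ?_)
  rw [Real.norm_of_nonneg (b.topBid_nonneg j), ← sum_utility_add_revenue, add_sub_cancel_left]
  exact Finset.single_le_sum (fun j _ => b.topBid_nonneg j) (Finset.mem_univ j)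

theorem IsCoarseCorrelatedEq.integral_outcomeWelfare (hσ : IsCoarseCorrelatedEq R f σ) :
    ∫ b, outcomeWelfare R f b ∂σ =
      ∑ i, ∫ b, utility R f i b ∂σ + ∑ j, ∫ b : BidProfile n m, b.topBid j ∂σ := by
  simp_rw [← sum_utility_add_revenue]
  rw [MeasureTheory.integral_add
    (MeasureTheory.integrable_finsetSum _ fun i _ => hσ.integrable_utility i)
    (MeasureTheory.integrable_finsetSum _ fun j _ => hσ.integrable_topBid j),
    MeasureTheory.integral_finsetSum _ fun i _ => hσ.integrable_utility i,
    MeasureTheory.integral_finsetSum _ fun j _ => hσ.integrable_topBid j]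

/-- In equilibrium, a bidder valuing each of the blocks at `c` obtains at least half of their
total value minus `k` times the expected price of `X`. -/
theorem IsCoarseCorrelatedEq.half_le (hσ : IsCoarseCorrelatedEq R f σ) (i : Fin n)
    (hf : Monotone (f i)) {k : ℕ} (hk : 0 < k) {X : Finset (Fin m)}
    {J : Finset ℕ} {Q : ℕ → Finset (Fin m)} {c : ℝ} (hc : 0 ≤ c) (hQX : ∀ l, Q l ⊆ X)
    (hcard : ∀ l, (Q l).card ≤ k) (hdisj : ∀ l l', l ≠ l' → Disjoint (Q l) (Q l'))
    (hle : ∀ I ⊆ J, c * I.card ≤ f i (I.biUnion Q)) :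
    c * J.card / 2 ≤ ∫ b, utility R f i b ∂σ + k * ∑ j ∈ X, ∫ b : BidProfile n m, b.topBid j ∂σ := by
  have := hσ.isProbabilityMeasure
  lift c to ℝ≥0 using hc
  -- The uniform random bid is replaced by `N` fixed deviations on a grid; the relative loss `1/N`
  -- vanishes in the limit.
  have key : ∀ N : ℕ, 0 < N → c * J.card / 2 - (c * J.card / 2) / N ≤
      ∫ b, utility R f i b ∂σ + k * ∑ j ∈ X, ∫ b : BidProfile n m, b.topBid j ∂σ := by
    intro N hN
    have hN' : (0 : ℝ) < N := by exact_mod_cast hN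
    have hint : MeasureTheory.Integrable (fun b : BidProfile n m => ∑ j ∈ X, b.topBid j) σ :=
      MeasureTheory.integrable_finsetSum _ fun j _ => hσ.integrable_topBid j
    have h1 := MeasureTheory.integral_mono
      ((MeasureTheory.integrable_const (μ := σ) (c * J.card * ((N - 1) / 2) : ℝ)).sub
        (hint.const_mul (k * N)))
      (MeasureTheory.integrable_finsetSum _ fun t _ => integrable_utility_update R f i σ _)
      (le_sum_utility_flatBid R f i hf hk hN hQX hcard hdisj hle)
    rw [MeasureTheory.integral_finsetSum _ fun t _ => integrable_utility_update R f i σ _] at h1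
    have h2 := h1.trans (Finset.sum_le_sum fun t _ => hσ.no_deviation i _)
    simp only [Pi.sub_apply] at h2
    rw [MeasureTheory.integral_sub (MeasureTheory.integrable_const _) (hint.const_mul _),
      MeasureTheory.integral_const_mul (k * N : ℝ), MeasureTheory.integral_finsetSum _
      fun j _ => hσ.integrable_topBid j, Finset.sum_const, Finset.card_range, nsmul_eq_mul] at h2
    simp only [MeasureTheory.integral_const, MeasureTheory.probReal_univ, one_smul] at h2
    refine le_of_mul_le_mul_left ?_ hN'
    have h3 : (N : ℝ) * (c * J.card / 2 - (c * J.card / 2) / N) = c * J.card * ((N - 1) / 2) := by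
      field_simp
    rw [h3]
    linarith
  have hlim : Filter.Tendsto (fun N : ℕ => (c * J.card / 2 - (c * J.card / 2) / N : ℝ))
      Filter.atTop (nhds (c * J.card / 2 - 0)) :=
    tendsto_const_nhds.sub (tendsto_const_div_atTop_nhds_zero_nat _)
  rw [sub_zero] at hlim
  exact le_of_tendsto hlim ((Filter.eventually_gt_atTop 0).mono key)

/-- The welfare of an allocation exceeds the expected welfare in equilibrium by at most a factor
`8 * d * harmonic r`. -/
theorem IsCoarseCorrelatedEq.welfare_le (hσ : IsCoarseCorrelatedEq R f σ) {d r : ℕ} (hd : 1 ≤ d)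
    (hr : m ≤ 2 * d * r) (hf : ∀ i, f i ∈ maxClosure (SAW m d)) (a : Allocation n m) :
    welfare f a ≤ 8 * d * harmonic r * ∫ b, outcomeWelfare R f b ∂σ := by
  have hH := harmonic_nonneg r
  have hd' : (1 : ℝ) ≤ d := by exact_mod_cast hd
  have hbidder : ∀ i, f i (a.bundle i) ≤ 4 * harmonic r * (∫ b, utility R f i b ∂σ +
      (2 * d) * ∑ j ∈ a.bundle i, ∫ b : BidProfile n m, b.topBid j ∂σ) := fun i => by
    obtain ⟨J, Q, c, hc, hQX, hcard, hdisj, hle, hX⟩ :=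
      maxClosure.exists_blocks (hf i) hr (a.bundle i)
    have h := hσ.half_le i (maxClosure.monotone (hf i)) (by omega : 0 < 2 * d) hc hQX hcard
      hdisj hle
    push_cast at h
    have h2 := mul_le_mul_of_nonneg_left h (by positivity : (0 : ℝ) ≤ 4 * harmonic r)
    linarith
  have hu : ∀ i, 0 ≤ ∫ b, utility R f i b ∂σ := fun i =>
    hσ.integral_utility_nonneg i fun S => maxClosure.map_empty (hf i) ▸
      maxClosure.monotone (hf i) (Finset.empty_subset S)
  have hU : 0 ≤ ∑ i, ∫ b, utility R f i b ∂σ := Finset.sum_nonneg fun i _ => hu i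
  refine (Finset.sum_le_sum fun i _ => hbidder i).trans ?_
  rw [← Finset.mul_sum, Finset.sum_add_distrib, ← Finset.mul_sum,
    a.sum_bundle fun _ j => ∫ b : BidProfile n m, b.topBid j ∂σ, hσ.integral_outcomeWelfare]
  -- Raises the coefficient of the utilities from `1` to `2 * d`, matching that of the revenue.
  have h3 := mul_le_mul_of_nonneg_left hU (by nlinarith : (0 : ℝ) ≤ 4 * harmonic r * (2 * d - 1))
  linarith

theorem mainTheorem9 :
    (∀ (n m d : ℕ), 1 ≤ d → ∀ (R : WinnerRule n m) (f : Fin n → SetFn m),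
      (∀ i, f i ∈ maxClosure (SAW m d)) →
        priceOfAnarchy R f
          ≤ ENNReal.ofReal (8 * (d : ℝ) * (harmonic ⌈(m : ℚ) / (2 * (d : ℚ))⌉₊ : ℝ))) ∧
    (∃ C : ℝ, ∀ (m d : ℕ), 2 ≤ m → 1 ≤ d →
      8 * (d : ℝ) * (harmonic ⌈(m : ℚ) / (2 * (d : ℚ))⌉₊ : ℝ) ≤ C * ((d : ℝ) * Real.log m)) := by
  constructor
  · intro n m d hd R f hf
    refine iSup₂_le fun σ hσ => ENNReal.div_le_of_le_mul ?_
    have hr : m ≤ 2 * d * ⌈(m : ℚ) / (2 * (d : ℚ))⌉₊ := by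
      have h := Nat.le_ceil ((m : ℚ) / (2 * (d : ℚ)))
      rw [div_le_iff₀' (by positivity)] at h
      exact_mod_cast h
    have hH := harmonic_nonneg ⌈(m : ℚ) / (2 * (d : ℚ))⌉₊
    rw [← ENNReal.ofReal_mul (by positivity)]
    refine ENNReal.ofReal_le_ofReal ?_
    -- Nonnegativity of the bound covers the case of no allocations, where the real supremum is `0`.
    refine Real.iSup_le (hσ.welfare_le hd hr hf) (mul_nonneg (by positivity) ?_)
    rw [hσ.integral_outcomeWelfare]
    refine add_nonneg (Finset.sum_nonneg fun i _ => hσ.integral_utility_nonneg i fun S =>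
      maxClosure.map_empty (hf i) ▸ maxClosure.monotone (hf i) (Finset.empty_subset S))
      (Finset.sum_nonneg fun j _ => MeasureTheory.integral_nonneg fun b => b.topBid_nonneg j)
  -- From `H_m ≤ 1 + log m`, with the `1` absorbed by `log m / log 2 ≥ 1`.
  · refine ⟨8 * (1 / Real.log 2 + 1), fun m d hm hd => ?_⟩
    have hlog2 : 0 < Real.log 2 := Real.log_pos one_lt_two
    have hceil : ⌈(m : ℚ) / (2 * (d : ℚ))⌉₊ ≤ m := by
      refine Nat.ceil_le.2 (div_le_self m.cast_nonneg ?_)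
      have : (1 : ℚ) ≤ d := by exact_mod_cast hd
      linarith
    have hlog : Real.log 2 ≤ Real.log m := Real.log_le_log two_pos (by exact_mod_cast hm)
    have h1 : (1 : ℝ) ≤ 1 / Real.log 2 * Real.log m := by
      rw [one_div_mul_eq_div]
      exact (one_le_div hlog2).2 hlog
    have h2 : (harmonic ⌈(m : ℚ) / (2 * (d : ℚ))⌉₊ : ℝ) ≤ (1 / Real.log 2 + 1) * Real.log m :=
      ((harmonic_mono hceil).trans (harmonic_le_one_add_log m)).trans (by linarith)
    have h3 := mul_le_mul_of_nonneg_left h2 (by positivity : (0 : ℝ) ≤ 8 * d)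
    linarith
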